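/- **Conventions.** Simplicial complexes are families of finite sets closed under taking subsets (with $\emptyset$ allowed as a face), and $\tilde H_i(K)$ denotes reduced simplicial homology with coefficients in $\mathbb Z/2$. A complex $K$ is *$k$-connected* if $\tilde H_i(K)=0$ for all $-1\le i\le k$; $\eta(K)\in\{0,1,2,\dots\}\cup\{\infty\}$ is the maximal integer $k$ for which $K$ is $(k-2)$-connected, and $\eta(K)=\infty$ if there is no maximal one. A set of vertices of a hypergraph $\mathcal H$ is *independent* if it contains no edge of $\mathcal H$; $\mathcal I(\mathcal H)$ is the complex of independent sets. A finite set of points of $\mathbb R^d$ is *in general position* if each of its subsets with at most $d+1$ points is affinely independent. For $P\subseteq\mathbb R^d$, $G(P)$ is the complex of the finite subsets of $P$ in general position and $\varphi(P)$ is the maximal size of such a subset ($\infty$ if the sizes are unbounded). All of $r,k,d$ are non-negative integers. For $r=0$ the product $(r-1)\binom{2k-2}{r-1}$ is read as $0$. (For $k=0$ the conclusions $\eta\ge k$ in (1) and (2) hold for every complex.) **Theorem.** 1. Let $M$ be a matroid of rank $r$ on $X$, let $Y\subseteq X$ be finite, and let $\mathcal H_Y$ be the hypergraph on the vertex set $Y$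 with edges $\{S\subseteq Y: |S|\le r,\ S \text{ is a circuit of } M\}$. Suppose that $r\le 2k-1$ or $k\le 1$. If $\mathcal H_Y$ has an independent set of size greater than $(r-1)\binom{2k-2}{r-1}$, then $\eta(\mathcal I(\mathcal H_Y))\ge k$. 2. Let $P\subseteq\mathbb R^d$, and suppose that $d\le 2k-2$ or $k\le 2$. If $\varphi(P)>d\binom{2k-2}{d}$, then $\eta(G(P))\ge k$. 3. For every $d\ge 0$ and $k\ge0$ there is a minimum integer $g_d(k)$ such that, for every $P\subseteq\mathbb R^d$ with $\varphi(P)\ge g_d(k)$, the complex $G(P)$ is $k$-connected; and for every fixed $d$, $g_d(k)=O(k^d)$ as $k\to\infty$. -/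

import Mathlib

/-- An abstract simplicial complex on the vertices of type `V`: a family of finite sets that is
closed under taking subsets. The empty set counts as a face; both the void complex (no face) and
the empty complex (whose only face is `∅`) are allowed. -/
structure SetComplex (V : Type*) where
  /-- the faces -/
  faces : Set (Finset V)
  /-- subsets of faces are faces -/
  down_closed : ∀ ⦃s t : Finset V⦄, s ∈ faces → t ⊆ s → t ∈ faces

namespace SetComplex

variable {V : Type*}

open Classical in
/-- The simplicial boundary operator over `ℤ/2`, on the space of all finite chains of finite
subsets of `V`: it sends a set `σ` to the sum of the sets `σ \ {v}`, `v ∈ σ`. The vertices are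
sent to `∅`, so that it also gives the augmentation. -/
noncomputable def boundary (V : Type*) :
    (Finset V →₀ ZMod 2) →ₗ[ZMod 2] (Finset V →₀ ZMod 2) :=
  Finsupp.linearCombination (ZMod 2) fun σ : Finset V =>
    ∑ v ∈ σ, Finsupp.single (σ.erase v) (1 : ZMod 2)

/-- Consecutive boundary operators compose to zero. -/
theorem boundary_boundary (c : Finset V →₀ ZMod 2) : boundary V (boundary V c) = 0 := by
  classical
  suffices h : (boundary V).comp (boundary V) = 0 from LinearMap.congr_fun h c
  refine Finsupp.lhom_ext' fun σ => LinearMap.ext_ring ?_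
  simp only [boundary, LinearMap.comp_apply, Finsupp.lsingle_apply,
    Finsupp.linearCombination_single, one_smul, map_sum, LinearMap.zero_apply]
  rw [Finset.sum_sigma']
  refine Finset.sum_involution (fun p _ => ⟨p.2, p.1⟩) ?_ ?_ ?_ ?_
  · rintro ⟨a, b⟩ _
    rw [Finset.erase_right_comm, ← Finsupp.single_add]
    simp [CharTwo.add_self_eq_zero]
  · rintro ⟨a, b⟩ h _ heq
    simp only [Finset.mem_sigma, Finset.mem_erase] at h
    simp only [Sigma.mk.injEq] at heq
    exact h.2.1 heq.1
  · rintro ⟨a, b⟩ h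
    simp only [Finset.mem_sigma, Finset.mem_erase] at h ⊢
    exact ⟨h.2.2, h.2.1.symm, h.1⟩
  · rintro ⟨a, b⟩ _
    rfl

/-- The `i`-dimensional chains of `K` over `ℤ/2`: the finite chains of faces with `i + 1`
vertices (for `i = -1` the only such face is `∅`). -/
noncomputable def chains (K : SetComplex V) (i : ℤ) : Submodule (ZMod 2) (Finset V →₀ ZMod 2) :=
  Finsupp.supported (ZMod 2) (ZMod 2) {σ : Finset V | σ ∈ K.faces ∧ (σ.card : ℤ) = i + 1}

/-- The `i`-dimensional reduced cycles of `K`. -/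
noncomputable def cycles (K : SetComplex V) (i : ℤ) : Submodule (ZMod 2) (Finset V →₀ ZMod 2) :=
  K.chains i ⊓ LinearMap.ker (boundary V)

/-- The `i`-dimensional boundaries of `K`. -/
noncomputable def boundaries (K : SetComplex V) (i : ℤ) :
    Submodule (ZMod 2) (Finset V →₀ ZMod 2) :=
  (K.chains (i + 1)).map (boundary V)

/-- The quotient `Z / B` for submodules `B ≤ Z` of a module. -/
abbrev Subquotient {R W : Type*} [Ring R] [AddCommGroup W] [Module R W] (Z B : Submodule R W) :
    Type _ :=
  ↥Z ⧸ B.submoduleOf Z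

theorem subsingleton_subquotient_iff {R W : Type*} [Ring R] [AddCommGroup W] [Module R W]
    (Z B : Submodule R W) : Subsingleton (Subquotient Z B) ↔ Z ≤ B := by
  rw [Submodule.Quotient.subsingleton_iff, Submodule.submoduleOf,
    Submodule.comap_subtype_eq_top]

/-- Every boundary is a cycle. -/
theorem boundaries_le_cycles (K : SetComplex V) (i : ℤ) : K.boundaries i ≤ K.cycles i := by
  classical
  rintro _ ⟨c, hc, rfl⟩
  refine ⟨?_, boundary_boundary c⟩
  rw [boundary, Finsupp.linearCombination_apply]
  refine Submodule.sum_mem _ fun σ hσ => Submodule.smul_mem _ _ (Submodule.sum_mem _ fun v hv => ?_)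
  have h := hc hσ
  refine Finsupp.single_mem_supported _ _ ⟨K.down_closed h.1 (σ.erase_subset v), ?_⟩
  have h1 := h.2
  have h2 := Finset.card_erase_add_one hv
  omega

/-- The `i`-dimensional reduced homology group of `K` with coefficients in `ℤ/2`. -/
abbrev ReducedHomology (K : SetComplex V) (i : ℤ) : Type _ :=
  Subquotient (K.cycles i) (K.boundaries i)

/-- The reduced homology vanishes in dimension `i` if and only if every cycle is a boundary. -/
theorem subsingleton_reducedHomology_iff (K : SetComplex V) (i : ℤ) :
    Subsingleton (K.ReducedHomology i) ↔ K.cycles i ≤ K.boundaries i :=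
  subsingleton_subquotient_iff _ _

/-- `K` is (homologically) `k`-connected: the reduced homology vanishes in the dimensions
`-1, …, k`. -/
def IsHomConnected (K : SetComplex V) (k : ℤ) : Prop :=
  ∀ i : ℤ, -1 ≤ i → i ≤ k → Subsingleton (K.ReducedHomology i)

/-- The homological connectivity `η(K)`: the maximal integer `k` for which `K` is
`(k - 2)`-connected, and `⊤` if there is no maximal one. (Every complex is `(-2)`-connected, so
that only `k ≥ 0` matter.) -/
noncomputable def eta (K : SetComplex V) : ℕ∞ :=
  ⨆ k ∈ {k : ℕ | K.IsHomConnected ((k : ℤ) - 2)}, (k : ℕ∞)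

end SetComplex

namespace Hypergraph

variable {V : Type*}

/-- A set of vertices is independent if it contains no edge. -/
def IsIndependent (H : Hypergraph V) (W : Set V) : Prop :=
  W ⊆ H.vertexSet ∧ ∀ e ∈ H.edgeSet, ¬ e ⊆ W

/-- The independence complex of a hypergraph: its faces are the (finite) independent sets. -/
def independenceComplex (H : Hypergraph V) : SetComplex V where
  faces := {s | H.IsIndependent (s : Set V)}
  down_closed := fun _ _ hs hts =>
    ⟨(Finset.coe_subset.2 hts).trans hs.1,
      fun e he h => hs.2 e he (h.trans (Finset.coe_subset.2 hts))⟩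

end Hypergraph

/-- The hypergraph on `Y` whose edges are the circuits of `M` of size at most `r` contained
in `Y`. -/
def Matroid.circuitHypergraph {α : Type*} (M : Matroid α) (r : ℕ) (Y : Finset α) :
    Hypergraph α where
  vertexSet := Y
  edgeSet := {S | S ⊆ (Y : Set α) ∧ S.encard ≤ r ∧ M.IsCircuit S}
  subset_vertexSet_of_mem_edgeSet' := fun _ h => h.1

/-- A finite set of points of `ℝ^d` is in general position if each of its subsets with at most
`d + 1` points is affinely independent. -/
def InGeneralPosition (d : ℕ) (S : Finset (EuclideanSpace ℝ (Fin d))) : Prop :=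
  ∀ T ⊆ S, T.card ≤ d + 1 →
    AffineIndependent ℝ (fun x : T => (x : EuclideanSpace ℝ (Fin d)))

/-- The general position complex `G(P)` of a set `P` of points of `ℝ^d`: its faces are the finite
subsets of `P` in general position. -/
def generalPositionComplex (d : ℕ) (P : Set (EuclideanSpace ℝ (Fin d))) :
    SetComplex (EuclideanSpace ℝ (Fin d)) where
  faces := {S | (S : Set (EuclideanSpace ℝ (Fin d))) ⊆ P ∧ InGeneralPosition d S}
  down_closed := fun _ _ hs hts =>
    ⟨(Finset.coe_subset.2 hts).trans hs.1, fun T hT hc => hs.2 T (hT.trans hts) hc⟩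

/-- `φ(P)`: the maximal size of a subset of `P` in general position (`⊤` if these sizes are
unbounded, which can only happen for infinite `P`). -/
noncomputable def maxGeneralPosition (d : ℕ) (P : Set (EuclideanSpace ℝ (Fin d))) : ℕ∞ :=
  ⨆ S ∈ (generalPositionComplex d P).faces, (S.card : ℕ∞)

/-- The numbers `n` such that `G(P)` is `k`-connected for every set `P` of points of `ℝ^d` with
`φ(P) ≥ n`. -/
def generalPositionThresholds (d k : ℕ) : Set ℕ :=
  {n | ∀ P : Set (EuclideanSpace ℝ (Fin d)), (n : ℕ∞) ≤ maxGeneralPosition d P →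
    (generalPositionComplex d P).IsHomConnected k}

/-! The engine is a domination criterion. Suppose that for every set `W` of at most `2k - 2`
vertices some vertex `a` outside `W` lies in no edge contained in `W ∪ {a}`. Then all cycles of
faces of size less than `k` bound in the independence complex (`cyclesBound_independentSets`). The
induction is on the number of edges: a vertex in no edge is a cone apex; otherwise an edge `f` is
removed, and `cyclesBound_of_link` needs only connectivity without `f` and, in lower degree, of the
link of `f`.

The edges here are circuits, so a dominated vertex is in the closure of at most `r - 1` points of
`W`. If a small `W` dominated everything, a large independent set `A` would be covered by the
closures of the `(r - 1)`-subsets of `W`. Each closure contains at most `r - 1` points of `A`,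
whence the bound `(r - 1) * (2k - 2).choose (r - 1)`. `cyclesBound_of_closure` does this for an
abstract closure, applied to matroid closure and, with `r = d + 1`, to affine span. -/

namespace SetComplex

variable {V : Type*}

/-! ### Cycles and boundaries indexed by size; cones and links -/

/-- The chains (over `ℤ/2`) of members of `F` of size `m`. -/
noncomputable def sizeChains (F : Set (Finset V)) (m : ℕ) :
    Submodule (ZMod 2) (Finset V →₀ ZMod 2) :=
  Finsupp.supported (ZMod 2) (ZMod 2) {σ : Finset V | σ ∈ F ∧ σ.card = m}

/-- Every cycle of members of `F` of size `m` is the boundary of a chain of members of `F`. -/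
def CyclesBound (F : Set (Finset V)) (m : ℕ) : Prop :=
  ∀ c ∈ sizeChains F m, boundary V c = 0 → ∃ b ∈ sizeChains F (m + 1), boundary V b = c

/-- Faces of size `m` have dimension `m - 1`, so dimensions `-1, …, k - 2` become sizes `0, …, k -
1`. -/
theorem isHomConnected_iff_cyclesBound (K : SetComplex V) (k : ℕ) :
    K.IsHomConnected ((k : ℤ) - 2) ↔ ∀ m, m < k → CyclesBound K.faces m := by
  have hch (m : ℕ) : K.chains ((m : ℤ) - 1) = sizeChains K.faces m := by
    simp [chains, sizeChains]
  have hch' (m : ℕ) : K.chains ((m : ℤ) - 1 + 1) = sizeChains K.faces (m + 1) := by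
    rw [chains, sizeChains]
    congr 1
    ext σ
    simp only [Set.mem_ofPred_eq, and_congr_right_iff]
    omega
  have key (m : ℕ) : Subsingleton (K.ReducedHomology ((m : ℤ) - 1)) ↔ CyclesBound K.faces m := by
    rw [subsingleton_reducedHomology_iff, cycles, boundaries, hch, hch']
    constructor
    · intro h c hc h0
      exact h ⟨hc, h0⟩
    · rintro h c ⟨hc, h0⟩
      exact h c hc h0
  constructor
  · intro h m hm
    exact (key m).1 (h _ (by omega) (by omega))
  · intro h i hi hik
    obtain ⟨m, rfl⟩ : ∃ m : ℕ, i = (m : ℤ) - 1 := ⟨(i + 1).toNat, by omega⟩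
    exact (key m).2 (h m (by omega))

theorem IsHomConnected.le_eta {K : SetComplex V} {k : ℕ} (h : K.IsHomConnected ((k : ℤ) - 2)) :
    (k : ℕ∞) ≤ K.eta :=
  le_iSup₂_of_le k h le_rfl

open Classical in
theorem boundary_single (σ : Finset V) (a : ZMod 2) :
    boundary V (Finsupp.single σ a) = a • ∑ v ∈ σ, Finsupp.single (σ.erase v) (1 : ZMod 2) := by
  rw [boundary, Finsupp.linearCombination_single]

theorem linearCombination_mem_supported {ι κ : Type*} {f : ι → (κ →₀ ZMod 2)} {S : Set ι}
    {T : Set κ} (h : ∀ σ ∈ S, f σ ∈ Finsupp.supported (ZMod 2) (ZMod 2) T)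
    {c : ι →₀ ZMod 2} (hc : c ∈ Finsupp.supported (ZMod 2) (ZMod 2) S) :
    Finsupp.linearCombination (ZMod 2) f c ∈ Finsupp.supported (ZMod 2) (ZMod 2) T := by
  rw [Finsupp.linearCombination_apply]
  exact Submodule.sum_mem _ fun σ hσ => Submodule.smul_mem _ _ (h σ (hc hσ))

theorem boundary_mem_sizeChains {F : Set (Finset V)}
    (hF : ∀ ⦃s t : Finset V⦄, s ∈ F → t ⊆ s → t ∈ F) {m : ℕ} {c : Finset V →₀ ZMod 2}
    (hc : c ∈ sizeChains F (m + 1)) : boundary V c ∈ sizeChains F m := by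
  classical
  refine linearCombination_mem_supported (fun σ hσ => ?_) hc
  refine Submodule.sum_mem _ fun v hv => Finsupp.single_mem_supported _ _ ⟨?_, ?_⟩
  · exact hF hσ.1 (by convert σ.erase_subset v)
  · have := Finset.card_erase_of_mem hv
    have := hσ.2
    convert show (σ.erase v).card = m by omega

open Classical in
/-- Coning with apex `a`: sets containing `a` are sent to zero. -/
noncomputable def coneMap (a : V) : (Finset V →₀ ZMod 2) →ₗ[ZMod 2] (Finset V →₀ ZMod 2) :=
  Finsupp.linearCombination (ZMod 2) fun σ : Finset V =>
    if a ∈ σ then 0 else Finsupp.single (insert a σ) (1 : ZMod 2)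

/-- Coning is a contracting homotopy: a cycle is the boundary of its cone. -/
theorem boundary_coneMap (a : V) (c : Finset V →₀ ZMod 2) :
    boundary V (coneMap a c) + coneMap a (boundary V c) = c := by
  classical
  suffices h : (boundary V).comp (coneMap a) + (coneMap a).comp (boundary V) = LinearMap.id from
    LinearMap.congr_fun h c
  refine Finsupp.lhom_ext' fun σ => LinearMap.ext_ring ?_
  simp only [LinearMap.add_apply, LinearMap.comp_apply, Finsupp.lsingle_apply,
    LinearMap.id_apply, boundary_single, one_smul, map_sum]
  simp only [coneMap, Finsupp.linearCombination_single, one_smul]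
  by_cases ha : a ∈ σ
  · rw [if_pos ha, map_zero, zero_add, Finset.sum_eq_single_of_mem a ha]
    · rw [if_neg (Finset.notMem_erase a σ), Finset.insert_erase ha]
    · intro v _ hv
      rw [if_pos (Finset.mem_erase.2 ⟨hv.symm, ha⟩)]
  · rw [if_neg ha, boundary_single, one_smul, Finset.sum_insert ha, Finset.erase_insert ha,
      add_assoc, ← Finset.sum_add_distrib, Finset.sum_eq_zero, add_zero]
    intro v hv
    have hav : a ≠ v := fun h => ha (h ▸ hv)
    rw [if_neg (fun h => ha (Finset.mem_of_mem_erase h)), Finset.erase_insert_of_ne hav,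
      ← Finsupp.single_add, CharTwo.add_self_eq_zero, Finsupp.single_zero]

/-- If adding `a` to the members of size `m` keeps them in the family, then their cycles bound. -/
theorem cyclesBound_of_cone {F : Set (Finset V)} {m : ℕ} (a : V)
    (h : ∀ s ∈ F, ∀ t : Finset V, s.card = m → a ∉ s → (t : Set V) = insert a (s : Set V) → t ∈ F) :
    CyclesBound F m := by
  classical
  intro c hc h0
  refine ⟨coneMap a c, linearCombination_mem_supported (fun σ hσ => ?_) hc, ?_⟩
  · split_ifs with ha
    · exact Submodule.zero_mem _
    · refine Finsupp.single_mem_supported _ _ ⟨h σ hσ.1 _ hσ.2 ha (by simp), ?_⟩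
      convert (Finset.card_insert_of_notMem ha).trans (congrArg (· + 1) hσ.2)
  · have := boundary_coneMap a c
    rwa [h0, map_zero, add_zero] at this

open Classical in
/-- The map that removes `e` from the sets containing `e` and sends the other sets to zero. -/
noncomputable def linkMap (e : Finset V) :
    (Finset V →₀ ZMod 2) →ₗ[ZMod 2] (Finset V →₀ ZMod 2) :=
  Finsupp.linearCombination (ZMod 2) fun σ : Finset V =>
    if e ⊆ σ then Finsupp.single (σ \ e) (1 : ZMod 2) else 0

open Classical in
/-- The map that adds `e` to all sets. -/
noncomputable def joinMap (e : Finset V) :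
    (Finset V →₀ ZMod 2) →ₗ[ZMod 2] (Finset V →₀ ZMod 2) :=
  Finsupp.linearCombination (ZMod 2) fun σ : Finset V => Finsupp.single (σ ∪ e) (1 : ZMod 2)

theorem linkMap_boundary (e : Finset V) (c : Finset V →₀ ZMod 2) :
    linkMap e (boundary V c) = boundary V (linkMap e c) := by
  classical
  suffices h : (linkMap e).comp (boundary V) = (boundary V).comp (linkMap e) from
    LinearMap.congr_fun h c
  refine Finsupp.lhom_ext' fun σ => LinearMap.ext_ring ?_
  simp only [LinearMap.comp_apply, Finsupp.lsingle_apply, boundary_single, one_smul, map_sum]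
  simp only [linkMap, Finsupp.linearCombination_single, one_smul]
  by_cases he : e ⊆ σ
  · rw [if_pos he, boundary_single, one_smul]
    refine (Finset.sum_subset_zero_on_sdiff Finset.sdiff_subset ?_ ?_).symm
    · intro v hv
      simp only [Finset.mem_sdiff, not_and, not_not] at hv
      exact if_neg fun h => Finset.notMem_erase v σ (h (hv.2 hv.1))
    · intro v hv
      rw [Finset.mem_sdiff] at hv
      rw [if_pos (Finset.subset_erase.2 ⟨he, hv.2⟩), Finset.erase_sdiff_comm]
  · rw [if_neg he, map_zero]
    exact Finset.sum_eq_zero fun v _ => if_neg fun h => he (h.trans (Finset.erase_subset v σ))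

theorem linkMap_joinMap {e : Finset V} {c : Finset V →₀ ZMod 2}
    (hc : c ∈ Finsupp.supported (ZMod 2) (ZMod 2) {σ : Finset V | Disjoint σ e}) :
    linkMap e (joinMap e c) = c := by
  classical
  rw [joinMap, Finsupp.linearCombination_apply, Finsupp.sum, map_sum]
  conv_rhs => rw [← Finsupp.sum_single c]
  refine Finset.sum_congr rfl fun σ hσ => ?_
  rw [map_smul, linkMap, Finsupp.linearCombination_single, one_smul,
    if_pos Finset.subset_union_right, Finset.union_sdiff_cancel_right (hc hσ)]
  simp

/-- Removing `e` is injective on the supersets of `e`, so no coefficients merge; a chain killed by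
`linkMap e` has no member containing `e`. -/
theorem linkMap_apply {e σ : Finset V} (he : e ⊆ σ) (c : Finset V →₀ ZMod 2) (τ : Finset V)
    (hτ : (τ : Set V) = (σ : Set V) \ e) : linkMap e c τ = c σ := by
  classical
  obtain rfl : τ = σ \ e := by
    rw [← Finset.coe_inj]; simp [hτ]
  induction c using Finsupp.induction_linear with
  | zero => simp
  | add x y hx hy => simp [hx, hy]
  | single ρ a =>
    rw [linkMap, Finsupp.linearCombination_single]
    by_cases h : e ⊆ ρ
    · rw [if_pos h, Finsupp.smul_single, smul_eq_mul, mul_one]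
      by_cases hρ : ρ = σ
      · subst hρ; simp
      · rw [Finsupp.single_eq_of_ne (Ne.symm hρ), Finsupp.single_eq_of_ne]
        intro hh
        apply hρ
        rw [← Finset.sdiff_union_of_subset h, ← Finset.sdiff_union_of_subset he, hh]
    · rw [if_neg h, smul_zero, Finsupp.single_eq_of_ne]
      · rfl
      · rintro rfl; exact h he

theorem linkMap_eq_zero {e : Finset V} {c : Finset V →₀ ZMod 2}
    (hc : c ∈ Finsupp.supported (ZMod 2) (ZMod 2) {σ : Finset V | ¬ e ⊆ σ}) :
    linkMap e c = 0 := by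
  classical
  rw [linkMap, Finsupp.linearCombination_apply]
  exact Finset.sum_eq_zero fun σ hσ =>
    (congrArg _ (if_neg (hc hσ))).trans (smul_zero _)

/-- If the cycles of size `m` bound in `F`, and those of size `m + 1 - |e|` bound in the link `L`
of `e` in `F`, then the cycles of size `m` bound in the family of the members of `F` that do not
contain `e`. -/
theorem cyclesBound_of_link {F L : Set (Finset V)}
    (hF : ∀ ⦃s t : Finset V⦄, s ∈ F → t ⊆ s → t ∈ F) {e : Finset V}
    (hL : ∀ t : Finset V, t ∈ L ↔ Disjoint t e ∧
      ∃ s ∈ F, (s : Set V) = (t : Set V) ∪ e) {m : ℕ}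
    (hFm : CyclesBound F m) (hLm : ∀ l, l + e.card = m + 1 → CyclesBound L l) :
    CyclesBound {s | s ∈ F ∧ ¬ e ⊆ s} m := by
  classical
  intro c hc h0
  have hcF : c ∈ sizeChains F m :=
    fun σ hσ => ⟨(hc hσ).1.1, (hc hσ).2⟩
  have hce : linkMap e c = 0 := linkMap_eq_zero fun σ hσ => (hc hσ).1.2
  obtain ⟨b, hb, hbc⟩ := hFm c hcF h0
  have finish : ∀ b' ∈ sizeChains F (m + 1), linkMap e b' = 0 →
      b' ∈ sizeChains {s | s ∈ F ∧ ¬ e ⊆ s} (m + 1) := by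
    intro b' hb' hz σ hσ
    refine ⟨⟨(hb' hσ).1, fun he => ?_⟩, (hb' hσ).2⟩
    have := linkMap_apply he b' (σ \ e) (by simp)
    rw [hz] at this
    exact Finsupp.mem_support_iff.1 hσ this.symm
  by_cases hem : e.card ≤ m + 1
  · obtain ⟨l, hl⟩ : ∃ l, l + e.card = m + 1 := ⟨m + 1 - e.card, by omega⟩
    have hd : linkMap e b ∈ sizeChains L l := by
      refine linearCombination_mem_supported (fun σ hσ => ?_) hb
      split_ifs with he
      · refine Finsupp.single_mem_supported _ _ ⟨(hL _).2 ⟨?_, σ, hσ.1, ?_⟩, ?_⟩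
        · convert Finset.sdiff_disjoint
        · simp only [Finset.coe_sdiff]
          rw [Set.sdiff_union_of_subset (Finset.coe_subset.2 he)]
        · have := Finset.card_sdiff_add_card_eq_card he
          have := hσ.2
          convert show (σ \ e).card = l by omega
      · exact Submodule.zero_mem _
    -- The link part of `b` is a cycle because `c = ∂b` has no member containing `e`.
    obtain ⟨d, hdL, hdd⟩ := hLm l hl _ hd (by rw [← linkMap_boundary, hbc, hce])
    have hJ : joinMap e d ∈ sizeChains F (m + 1 + 1) := by
      refine linearCombination_mem_supported (fun σ hσ => ?_) hdL
      obtain ⟨hdis, s, hs, hse⟩ := (hL σ).1 hσ.1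
      obtain rfl : s = σ ∪ e := by rw [← Finset.coe_inj]; simp [hse]
      refine Finsupp.single_mem_supported _ _ ⟨by convert hs, ?_⟩
      have h1 := Finset.card_union_of_disjoint hdis
      have := hσ.2
      convert show (σ ∪ e).card = m + 1 + 1 by omega
    -- Subtracting a boundary leaves `∂b` unchanged and cancels the members of `b` that contain `e`.
    refine ⟨b - boundary V (joinMap e d), finish _ ?_ ?_, ?_⟩
    · exact Submodule.sub_mem _ hb (boundary_mem_sizeChains hF hJ)
    · rw [map_sub, linkMap_boundary, linkMap_joinMap, hdd, sub_self]
      exact Finsupp.supported_mono (fun σ hσ => ((hL σ).1 hσ.1).1) hdL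
    · rw [map_sub, boundary_boundary, sub_zero, hbc]
  · refine ⟨b, finish b hb (linkMap_eq_zero fun σ hσ he => hem ?_), hbc⟩
    exact (Finset.card_le_card he).trans (hb hσ).2.le

/-! ### Domination criterion for independence complexes -/

/-- The independent subsets of `U`, for a finite family `E` of forbidden sets. -/
def independentSets (U : Finset V) (E : Finset (Finset V)) : Set (Finset V) :=
  {s | s ⊆ U ∧ ∀ f ∈ E, ¬ f ⊆ s}

/-- If no small set dominates all vertices, then the cycles of small independent sets bound. -/
theorem cyclesBound_independentSets (U : Finset V) (E : Finset (Finset V)) (k : ℕ)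
    (hE : ∀ f ∈ E, f ⊆ U)
    (h : ∀ W ⊆ U, W.card + 2 ≤ 2 * k →
      ∃ a ∈ U, a ∉ W ∧ ∀ f ∈ E, a ∈ f → ¬ (f : Set V) ⊆ insert a (W : Set V))
    (m : ℕ) (hm : m < k) : CyclesBound (independentSets U E) m := by
  classical
  induction hn : E.card using Nat.strong_induction_on generalizing U E k m with
  | _ n ih =>
  subst hn
  -- `W = ∅` gives a vertex `a` with `{a}` not an edge, so every edge through `a` has at least two
  -- vertices.
  obtain ⟨a, haU, -, ha⟩ := h ∅ (Finset.empty_subset _) (by simp; omega)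
  by_cases hex : ∃ f ∈ E, a ∈ f
  · obtain ⟨f, hf, haf⟩ := hex
    have hcard := Finset.card_erase_lt_of_mem hf
    have hf2 : 2 ≤ f.card := by
      by_contra hlt
      refine ha f hf haf fun x hx => ?_
      have : f.card ≤ 1 := by omega
      simp [Finset.card_le_one.1 this x hx a haf]
    have heq : independentSets U E =
        {s | s ∈ independentSets U (E.erase f) ∧ ¬ f ⊆ s} := by
      ext s
      simp only [independentSets, Set.mem_ofPred_eq, Finset.mem_erase]
      constructor
      · rintro ⟨h1, h2⟩
        exact ⟨⟨h1, fun g hg => h2 g hg.2⟩, h2 f hf⟩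
      · rintro ⟨⟨h1, h2⟩, h3⟩
        refine ⟨h1, fun g hg => ?_⟩
        by_cases hgf : g = f
        · rwa [hgf]
        · exact h2 g ⟨hgf, hg⟩
    rw [heq]
    refine cyclesBound_of_link (L := independentSets (U \ f) ((E.erase f).image (· \ f)))
      ?_ ?_ ?_ ?_
    · intro s t hs hts
      exact ⟨hts.trans hs.1, fun g hg hgt => hs.2 g hg (hgt.trans hts)⟩
    · intro t
      constructor
      · rintro ⟨h1, h2⟩
        refine ⟨Finset.disjoint_of_subset_left h1 Finset.sdiff_disjoint, t ∪ f, ⟨?_, ?_⟩, by simp⟩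
        · exact Finset.union_subset (h1.trans Finset.sdiff_subset) (hE f hf)
        · intro g hg hgt
          refine h2 (g \ f) (Finset.mem_image_of_mem _ hg) ?_
          exact sdiff_le_iff.2 (hgt.trans (sup_comm _ _).le)
      · rintro ⟨hdis, s, ⟨h1, h2⟩, hs⟩
        obtain rfl : s = t ∪ f := by rw [← Finset.coe_inj]; simp [hs]
        refine ⟨Finset.subset_sdiff.2 ⟨Finset.subset_union_left.trans h1, hdis⟩, ?_⟩
        intro g hg hgt
        obtain ⟨g', hg', rfl⟩ := Finset.mem_image.1 hg
        refine h2 g' hg' ?_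
        exact (sdiff_le_iff.1 hgt).trans (sup_comm _ _).le
    · refine ih _ hcard U (E.erase f) k (fun g hg => hE g (Finset.mem_of_mem_erase hg)) ?_ m hm rfl
      intro W hW hWk
      obtain ⟨x, hx, hxW, hxf⟩ := h W hW hWk
      exact ⟨x, hx, hxW, fun g hg => hxf g (Finset.mem_of_mem_erase hg)⟩
    · intro l hl
      -- The parameter `k + 1 - |f|` fits: if `|W| ≤ 2(k + 1 - |f|) - 2`, then `|W ∪ f| ≤ 2k - |f| ≤
      -- 2k - 2`, since `|f| ≥ 2`.
      refine ih _ (Finset.card_image_le.trans_lt hcard) _ _ (k + 1 - f.card) ?_ ?_ l (by omega) rfl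
      · intro g hg
        obtain ⟨g', hg', rfl⟩ := Finset.mem_image.1 hg
        exact Finset.sdiff_subset_sdiff (hE g' (Finset.mem_of_mem_erase hg')) subset_rfl
      · intro W hW hWk
        have hc := Finset.card_union_le W f
        obtain ⟨x, hx, hxW, hxf⟩ := h (W ∪ f)
          (Finset.union_subset (hW.trans Finset.sdiff_subset) (hE f hf)) (by omega)
        rw [Finset.mem_union, not_or] at hxW
        refine ⟨x, Finset.mem_sdiff.2 ⟨hx, hxW.2⟩, hxW.1, ?_⟩
        intro g hg hxg hgW
        obtain ⟨g', hg', rfl⟩ := Finset.mem_image.1 hg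
        refine hxf g' (Finset.mem_of_mem_erase hg') (Finset.mem_sdiff.1 hxg).1 ?_
        intro y hy
        by_cases hyf : y ∈ f
        · simp [hyf]
        · have := hgW (Finset.mem_coe.2 (Finset.mem_sdiff.2 ⟨hy, hyf⟩))
          rcases this with rfl | h'
          · simp
          · right; simp [Finset.mem_coe.1 h']
  · push Not at hex
    refine cyclesBound_of_cone a ?_
    rintro s ⟨h1, h2⟩ t - - ht
    have ht' : t = insert a s := by rw [← Finset.coe_inj]; simp [ht]
    subst ht'
    refine ⟨Finset.insert_subset haU h1, fun f hf hft => h2 f hf ?_⟩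
    exact (Finset.subset_insert_iff_of_notMem (hex f hf)).1 hft

/-- A large set `A`, of which each closure of a small set contains only few points, makes the
cycles of small independent sets bound. -/
theorem cyclesBound_of_closure {U : Finset V} {E : Finset (Finset V)} {A : Finset V} {r k : ℕ}
    (cl : Finset V → Set V) (hcl : Monotone cl) (hsub : ∀ T : Finset V, T ⊆ U → (T : Set V) ⊆ cl T)
    (hAU : A ⊆ U) (hEU : ∀ f ∈ E, f ⊆ U) (hEr : ∀ f ∈ E, f.card ≤ r)
    (hEcl : ∀ f ∈ E, ∀ a ∈ f, ∀ T : Finset V, (T : Set V) = (f : Set V) \ {a} → a ∈ cl T)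
    (hA : ∀ B ⊆ A, ∀ T : Finset V, T.card + 1 ≤ r → (B : Set V) ⊆ cl T → B.card ≤ T.card)
    (hrk : 2 ≤ k → r ≤ 2 * k - 1)
    (hcard : (r - 1) * (2 * k - 2).choose (r - 1) < A.card)
    (m : ℕ) (hm : m < k) : CyclesBound (independentSets U E) m := by
  classical
  have hErase : ∀ f ∈ E, ∀ a ∈ f, a ∈ cl (f.erase a) := fun f hf a ha =>
    hEcl f hf a ha _ (Finset.coe_erase a f)
  obtain hr | hr := le_or_gt r 1
  -- For `r ≤ 1` an edge through `a ∈ A` would put `a` in the closure of `∅`, contrary to `hA`; so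
  -- `a` is a cone apex.
  · obtain ⟨a, ha⟩ : A.Nonempty := Finset.card_pos.1 (by omega)
    refine cyclesBound_of_cone a ?_
    rintro s ⟨h1, h2⟩ t - - ht
    have ht' : t = insert a s := by rw [← Finset.coe_inj]; simp [ht]
    subst ht'
    refine ⟨Finset.insert_subset (hAU ha) h1, fun f hf hft => h2 f hf ?_⟩
    refine (Finset.subset_insert_iff_of_notMem fun haf => ?_).1 hft
    have h3 := hErase f hf a haf
    have h4 := hEr f hf
    have h5 := Finset.card_erase_of_mem haf
    have h6 := Finset.card_pos.2 ⟨a, haf⟩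
    have := hA {a} (by simpa using ha) (f.erase a) (by omega) (by simpa using h3)
    rw [Finset.card_singleton] at this
    omega
  refine cyclesBound_independentSets U E k hEU (fun W hW hWk => ?_) m hm
  by_contra! hbad
  have hT : ∀ a ∈ A, ∃ T ⊆ W, T.card ≤ r - 1 ∧ a ∈ cl T := by
    intro a ha
    by_cases haW : a ∈ W
    · exact ⟨{a}, by simpa using haW, by rw [Finset.card_singleton]; omega, hsub _ (by simpa using hAU ha) (by simp)⟩
    · obtain ⟨f, hf, haf, hfW⟩ := hbad a (hAU ha) haW
      refine ⟨f.erase a, ?_, ?_, hErase f hf a haf⟩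
      · intro x hx
        rw [Finset.mem_erase] at hx
        exact (hfW hx.2).resolve_left hx.1
      · rw [Finset.card_erase_of_mem haf]
        exact Nat.sub_le_sub_right (hEr f hf) 1
  obtain hlt | hge := lt_or_ge W.card (r - 1)
  -- `W` has no `(r - 1)`-subset, but then `A ⊆ cl W` gives `|A| ≤ |W| < r - 1`. For `k = 1` the set
  -- `W` is empty; for `k ≥ 2`, `hrk` makes the binomial coefficient positive, so `|A| > r - 1`.
  · have hAW := hA A subset_rfl W (by omega) fun a ha => by
      obtain ⟨T, hTW, -, haT⟩ := hT a ha
      exact hcl hTW haT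
    obtain rfl | hk : k = 1 ∨ 2 ≤ k := by omega
    · omega
    · have := Nat.choose_pos (show r - 1 ≤ 2 * k - 2 by have := hrk hk; omega)
      have := Nat.le_mul_of_pos_right (r - 1) this
      omega
  · have hcover : A ⊆ (W.powersetCard (r - 1)).biUnion fun T => A.filter (· ∈ cl T) := by
      intro a ha
      obtain ⟨T, hTW, hTr, haT⟩ := hT a ha
      obtain ⟨T', hTT', hT'W, hT'⟩ := Finset.exists_subsuperset_card_eq hTW hTr hge
      exact Finset.mem_biUnion.2 ⟨T', Finset.mem_powersetCard.2 ⟨hT'W, hT'⟩,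
        Finset.mem_filter.2 ⟨ha, hcl hTT' haT⟩⟩
    have h1 := (Finset.card_le_card hcover).trans
      (Finset.card_biUnion_le_card_mul _ _ (r - 1) fun T hT => by
        have hTr := (Finset.mem_powersetCard.1 hT).2
        refine (hA _ (Finset.filter_subset _ _) T (by omega) ?_).trans hTr.le
        intro x hx
        exact (Finset.mem_filter.1 hx).2)
    rw [Finset.card_powersetCard, mul_comm] at h1
    have h2 : W.card.choose (r - 1) ≤ (2 * k - 2).choose (r - 1) :=
      Nat.choose_le_choose _ (by omega)
    have h3 := Nat.mul_le_mul_left (r - 1) h2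
    omega

end SetComplex

/-! ### Circuit hypergraphs of matroids -/

namespace Matroid

variable {α : Type*}

open Classical in
/-- The circuits of size at most `r` in `Y`, as a finite family of finite sets. -/
noncomputable def circuitFinset (M : Matroid α) (r : ℕ) (Y : Finset α) : Finset (Finset α) :=
  Y.powerset.filter fun f => f.card ≤ r ∧ M.IsCircuit (f : Set α)

theorem mem_circuitFinset {M : Matroid α} {r : ℕ} {Y f : Finset α} :
    f ∈ M.circuitFinset r Y ↔ f ⊆ Y ∧ f.card ≤ r ∧ M.IsCircuit (f : Set α) := by
  simp [circuitFinset]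

theorem circuitHypergraph_isIndependent_iff (M : Matroid α) (r : ℕ) (Y s : Finset α) :
    (M.circuitHypergraph r Y).IsIndependent (s : Set α) ↔
      s ∈ SetComplex.independentSets Y (M.circuitFinset r Y) := by
  constructor
  · rintro ⟨h1, h2⟩
    refine ⟨Finset.coe_subset.1 h1, fun f hf hfs => ?_⟩
    obtain ⟨h3, h4, h5⟩ := mem_circuitFinset.1 hf
    refine h2 f ⟨Finset.coe_subset.2 h3, ?_, h5⟩ (Finset.coe_subset.2 hfs)
    rw [Set.encard_coe_eq_coe_finsetCard]
    exact_mod_cast h4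
  · rintro ⟨h1, h2⟩
    refine ⟨Finset.coe_subset.2 h1, ?_⟩
    rintro e ⟨h3, h4, h5⟩ hes
    lift e to Finset α using s.finite_toSet.subset hes
    rw [Set.encard_coe_eq_coe_finsetCard] at h4
    exact h2 e (mem_circuitFinset.2 ⟨Finset.coe_subset.1 h3, by exact_mod_cast h4, h5⟩)
      (Finset.coe_subset.1 hes)

theorem le_eta_independenceComplex_circuitHypergraph (M : Matroid α) (r k : ℕ) (Y : Finset α)
    (hY : (Y : Set α) ⊆ M.E) (hrk : 2 ≤ k → r ≤ 2 * k - 1) (A : Finset α)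
    (hA : (M.circuitHypergraph r Y).IsIndependent (A : Set α))
    (hcard : (r - 1) * (2 * k - 2).choose (r - 1) < A.card) :
    (k : ℕ∞) ≤ (M.circuitHypergraph r Y).independenceComplex.eta := by
  refine SetComplex.IsHomConnected.le_eta
    ((SetComplex.isHomConnected_iff_cyclesBound _ k).2 fun m hm => ?_)
  have hfaces : (M.circuitHypergraph r Y).independenceComplex.faces =
      SetComplex.independentSets Y (M.circuitFinset r Y) :=
    Set.ext fun s => M.circuitHypergraph_isIndependent_iff r Y s
  rw [hfaces]
  have hAY := ((M.circuitHypergraph_isIndependent_iff r Y A).1 hA).1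
  refine SetComplex.cyclesBound_of_closure (A := A) (r := r) (k := k)
    (fun T => M.closure (T : Set α)) ?_ ?_ hAY ?_ ?_ ?_ ?_ hrk hcard m hm
  · intro S T hST
    exact M.closure_subset_closure (Finset.coe_subset.2 hST)
  · intro T hT
    exact M.subset_closure _ ((Finset.coe_subset.2 hT).trans hY)
  · exact fun f hf => (mem_circuitFinset.1 hf).1
  · exact fun f hf => (mem_circuitFinset.1 hf).2.1
  · intro f hf a ha T hT
    rw [hT]
    exact (mem_circuitFinset.1 hf).2.2.mem_closure_sdiff_singleton_of_mem ha
  · intro B hB T hTr hBT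
    by_contra! hlt
    -- `B'` has `|T| + 1 ≤ r` points, so a circuit inside it would be an edge in `A`. Hence `B'` is
    -- independent, too large for the closure of `T`.
    obtain ⟨B', hB'B, hB'⟩ := Finset.exists_subset_card_eq (Nat.succ_le_of_lt hlt)
    have hB'Y : (B' : Set α) ⊆ Y := Finset.coe_subset.2 ((hB'B.trans hB).trans hAY)
    have hindep : M.Indep (B' : Set α) := by
      rw [← M.not_dep_iff (hB'Y.trans hY)]
      intro hdep
      obtain ⟨C, hC, hcirc⟩ := hdep.exists_isCircuit_subset
      refine hA.2 C ⟨hC.trans hB'Y, ?_, hcirc⟩ (hC.trans (Finset.coe_subset.2 (hB'B.trans hB)))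
      refine (Set.encard_le_encard hC).trans ?_
      rw [Set.encard_coe_eq_coe_finsetCard, hB']
      exact_mod_cast hTr
    have h1 := hindep.encard_le_eRk_of_subset ((Finset.coe_subset.2 hB'B).trans hBT)
    rw [M.eRk_closure_eq] at h1
    have h2 := h1.trans (M.eRk_le_encard _)
    rw [Set.encard_coe_eq_coe_finsetCard, Set.encard_coe_eq_coe_finsetCard, hB'] at h2
    have : T.card + 1 ≤ T.card := by exact_mod_cast h2
    omega

end Matroid

/-! ### General position complexes -/

section GeneralPosition

variable {d : ℕ}

theorem mem_affineSpan_of_minimal_not_affineIndependent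
    {f : Finset (EuclideanSpace ℝ (Fin d))}
    (hf : Minimal (fun T : Finset (EuclideanSpace ℝ (Fin d)) =>
      ¬ AffineIndependent ℝ (fun x : T => (x : EuclideanSpace ℝ (Fin d)))) f)
    {a : EuclideanSpace ℝ (Fin d)} (ha : a ∈ f) :
    a ∈ affineSpan ℝ ((f : Set (EuclideanSpace ℝ (Fin d))) \ {a}) := by
  classical
  by_contra hspan
  have hind : AffineIndependent ℝ
      (fun x : (f.erase a : Finset _) => (x : EuclideanSpace ℝ (Fin d))) := by
    by_contra h
    exact Finset.notMem_erase a f (hf.le_of_le h (Finset.erase_subset a f) ha)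
  refine hf.prop (AffineIndependent.affineIndependent_of_notMem_span (i := ⟨a, ha⟩) ?_ ?_)
  · exact hind.comp_embedding ⟨fun y : {y : f // y ≠ ⟨a, ha⟩} =>
      (⟨y, Finset.mem_erase.2 ⟨fun h => y.2 (Subtype.ext h), y.1.2⟩⟩ : (f.erase a : Finset _)),
      fun y z h => Subtype.ext (Subtype.ext (by simpa using h))⟩
  · rwa [show _ '' _ = (f : Set (EuclideanSpace ℝ (Fin d))) \ {a} from ?_]
    ext x
    simp only [Set.mem_image, Set.mem_ofPred_eq, Set.mem_sdiff, Finset.mem_coe,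
      Set.mem_singleton_iff]
    constructor
    · rintro ⟨y, hy, rfl⟩
      exact ⟨y.2, fun h => hy (Subtype.ext h)⟩
    · rintro ⟨hx, hxa⟩
      exact ⟨⟨x, hx⟩, fun h => hxa (congrArg Subtype.val h), rfl⟩

theorem inGeneralPosition_of_card_le_two {S : Finset (EuclideanSpace ℝ (Fin d))}
    (hS : S.card ≤ 2) : InGeneralPosition d S := by
  classical
  intro T hT _
  by_contra hdep
  obtain ⟨f, hfT, hf⟩ := exists_minimal_le_of_wellFoundedLT
    (fun T : Finset (EuclideanSpace ℝ (Fin d)) =>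
      ¬ AffineIndependent ℝ (fun x : T => (x : EuclideanSpace ℝ (Fin d)))) T hdep
  obtain ⟨a, ha⟩ : f.Nonempty := by
    rw [Finset.nonempty_iff_ne_empty]
    rintro rfl
    exact hf.prop (affineIndependent_of_subsingleton ℝ _)
  have hspan := mem_affineSpan_of_minimal_not_affineIndependent hf ha
  rw [← Finset.coe_erase] at hspan
  have h1 : (f.erase a).card ≤ 1 := by
    have := Finset.card_le_card (hfT.trans hT)
    rw [Finset.card_erase_of_mem ha]
    omega
  obtain h0 | ⟨b, hb⟩ := (f.erase a).eq_empty_or_nonempty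
  · rw [h0, Finset.coe_empty, AffineSubspace.span_empty] at hspan
    exact AffineSubspace.notMem_bot ℝ _ a hspan
  · have hfb : f.erase a = {b} := Finset.eq_singleton_iff_unique_mem.2
      ⟨hb, fun x hx => Finset.card_le_one.1 h1 x hx b hb⟩
    rw [hfb, Finset.coe_singleton, AffineSubspace.mem_affineSpan_singleton] at hspan
    exact (Finset.mem_erase.1 hb).1 hspan.symm

open Classical in
/-- The minimal affinely dependent subsets of `Y` with at most `d + 1` points. -/
noncomputable def affineCircuitFinset (Y : Finset (EuclideanSpace ℝ (Fin d))) :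
    Finset (Finset (EuclideanSpace ℝ (Fin d))) :=
  Y.powerset.filter fun f => f.card ≤ d + 1 ∧
    Minimal (fun T : Finset (EuclideanSpace ℝ (Fin d)) =>
      ¬ AffineIndependent ℝ (fun x : T => (x : EuclideanSpace ℝ (Fin d)))) f

theorem mem_independentSets_affineCircuitFinset {Y s : Finset (EuclideanSpace ℝ (Fin d))} :
    s ∈ SetComplex.independentSets Y (affineCircuitFinset Y) ↔
      s ⊆ Y ∧ InGeneralPosition d s := by
  classical
  refine and_congr_right fun hsY => ⟨fun h T hT hcard => ?_, fun h f hf hfs => ?_⟩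
  · by_contra hdep
    obtain ⟨f, hfT, hf⟩ := exists_minimal_le_of_wellFoundedLT
      (fun T : Finset (EuclideanSpace ℝ (Fin d)) =>
        ¬ AffineIndependent ℝ (fun x : T => (x : EuclideanSpace ℝ (Fin d)))) T hdep
    refine h f (Finset.mem_filter.2 ⟨?_, ?_, hf⟩) (hfT.trans hT)
    · exact Finset.mem_powerset.2 ((hfT.trans hT).trans hsY)
    · exact (Finset.card_le_card hfT).trans hcard
  · obtain ⟨-, h2, h3⟩ := Finset.mem_filter.1 hf
    exact h3.prop (h f hfs h2)

theorem cyclesBound_affineCircuitFinset {k : ℕ} {A Y : Finset (EuclideanSpace ℝ (Fin d))}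
    (hdk : 2 ≤ k → d ≤ 2 * k - 2) (hAY : A ⊆ Y) (hA : InGeneralPosition d A)
    (hcard : d * (2 * k - 2).choose d < A.card) (m : ℕ) (hm : m < k) :
    SetComplex.CyclesBound (SetComplex.independentSets Y (affineCircuitFinset Y)) m := by
  classical
  refine SetComplex.cyclesBound_of_closure (A := A) (r := d + 1) (k := k)
    (fun T => affineSpan ℝ (T : Set (EuclideanSpace ℝ (Fin d)))) ?_ ?_ hAY ?_ ?_ ?_ ?_
    (fun hk => by have := hdk hk; omega) hcard m hm
  · intro S T hST
    exact affineSpan_mono ℝ (Finset.coe_subset.2 hST)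
  · exact fun T _ => subset_affineSpan ℝ _
  · exact fun f hf => Finset.mem_powerset.1 (Finset.mem_filter.1 hf).1
  · exact fun f hf => (Finset.mem_filter.1 hf).2.1
  · intro f hf a ha T hT
    rw [hT]
    exact mem_affineSpan_of_minimal_not_affineIndependent (Finset.mem_filter.1 hf).2.2 ha
  · intro B hB T hTr hBT
    by_contra! hlt
    obtain ⟨B', hB'B, hB'⟩ := Finset.exists_subset_card_eq (Nat.succ_le_of_lt hlt)
    have hind := hA B' (hB'B.trans hB) (by omega)
    have := hind.card_le_card_of_subset_affineSpan ((Finset.coe_subset.2 hB'B).trans hBT)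
    omega

theorem generalPositionComplex_isHomConnected (k : ℕ) (P : Set (EuclideanSpace ℝ (Fin d)))
    (hdk : 3 ≤ k → d ≤ 2 * k - 2)
    (hP : ((d * (2 * k - 2).choose d : ℕ) : ℕ∞) < maxGeneralPosition d P) :
    (generalPositionComplex d P).IsHomConnected ((k : ℤ) - 2) := by
  classical
  obtain ⟨A, hA, hcard⟩ : ∃ A ∈ (generalPositionComplex d P).faces,
      d * (2 * k - 2).choose d < A.card := by
    rw [maxGeneralPosition, lt_iSup_iff] at hP
    obtain ⟨A, hA⟩ := hP
    rw [lt_iSup_iff] at hA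
    obtain ⟨hA, h⟩ := hA
    exact ⟨A, hA, by exact_mod_cast h⟩
  rw [SetComplex.isHomConnected_iff_cyclesBound]
  intro m hm
  by_cases hdk' : 2 ≤ k → d ≤ 2 * k - 2
  -- `P` may be infinite, but the cycle `c` and the set `A` involve only finitely many points, to
  -- which the finite case applies.
  · intro c hc h0
    have hYP : ((c.support.biUnion id ∪ A : Finset _) : Set (EuclideanSpace ℝ (Fin d))) ⊆ P := by
      intro x hx
      simp only [Finset.coe_union, Finset.coe_biUnion, id, Set.mem_union, Set.mem_iUnion] at hx
      rcases hx with ⟨s, hs, hx⟩ | hx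
      · exact (hc hs).1.1 hx
      · exact hA.1 hx
    have hcY : c ∈ SetComplex.sizeChains (SetComplex.independentSets (c.support.biUnion id ∪ A)
        (affineCircuitFinset (c.support.biUnion id ∪ A))) m := by
      intro s hs
      refine ⟨mem_independentSets_affineCircuitFinset.2 ⟨?_, (hc hs).1.2⟩, (hc hs).2⟩
      exact (Finset.subset_biUnion_of_mem id hs).trans Finset.subset_union_left
    obtain ⟨b, hb, hbc⟩ := cyclesBound_affineCircuitFinset hdk'
      Finset.subset_union_right hA.2 hcard m hm c hcY h0
    refine ⟨b, fun s hs => ⟨?_, (hb hs).2⟩, hbc⟩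
    obtain ⟨h1, h2⟩ := mem_independentSets_affineCircuitFinset.1 (hb hs).1
    exact ⟨(Finset.coe_subset.2 h1).trans hYP, h2⟩
  · push Not at hdk'
    -- Here `k = 2` and `d > 2`. Only cycles of size at most 1 matter, and coning them yields sets
    -- of at most two points, always in general position.
    obtain ⟨a, ha⟩ : A.Nonempty := Finset.card_pos.1 (by omega)
    refine SetComplex.cyclesBound_of_cone a ?_
    intro s hs t hsm has ht
    obtain rfl : t = insert a s := by rw [← Finset.coe_inj]; simp [ht]
    refine ⟨?_, inGeneralPosition_of_card_le_two ?_⟩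
    · rw [ht]
      exact Set.insert_subset (hA.1 ha) hs.1
    · rw [Finset.card_insert_of_notMem has]
      omega

theorem mem_generalPositionThresholds {k K : ℕ} (hk : k + 2 ≤ K) (hd : d ≤ 2 * K - 2) :
    d * (2 * K - 2).choose d + 1 ∈ generalPositionThresholds d k := by
  intro P hP i hi hik
  refine generalPositionComplex_isHomConnected K P (fun _ => hd) ?_ i hi (by omega)
  exact lt_of_lt_of_le (by exact_mod_cast Nat.lt_succ_self _) hP

theorem exists_isLeast_generalPositionThresholds (d : ℕ) :
    ∃ g : ℕ → ℕ, (∀ k : ℕ, IsLeast (generalPositionThresholds d k) (g k)) ∧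
      (fun k : ℕ => (g k : ℝ)) =O[Filter.atTop] (fun k : ℕ => (k : ℝ) ^ d) := by
  -- The choice `K = k + 2 + d` ensures `d ≤ 2K - 2` for every `k`. For the growth rate, `K = k + 2`
  -- suffices once `k > d`.
  refine ⟨fun k => sInf (generalPositionThresholds d k), fun k => ⟨Nat.sInf_mem ⟨_,
    mem_generalPositionThresholds (K := k + 2 + d) (by omega) (by omega)⟩,
    fun n hn => Nat.sInf_le hn⟩, ?_⟩
  refine Asymptotics.IsBigO.of_bound (d * 4 ^ d + 1) ?_
  filter_upwards [Filter.eventually_ge_atTop (d + 1)] with k hk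
  have h1 := Nat.sInf_le (mem_generalPositionThresholds (d := d) (k := k) (K := k + 2) le_rfl
    (by omega))
  have h2 : (2 * (k + 2) - 2).choose d ≤ (4 * k) ^ d :=
    (Nat.choose_le_pow _ _).trans (Nat.pow_le_pow_left (by omega) d)
  have h3 : 1 ≤ k ^ d := Nat.one_le_pow _ _ (by omega)
  have h4 : sInf (generalPositionThresholds d k) ≤ (d * 4 ^ d + 1) * k ^ d := by
    calc _ ≤ d * (4 * k) ^ d + 1 := h1.trans (Nat.add_le_add_right (Nat.mul_le_mul_left d h2) 1)
      _ ≤ (d * 4 ^ d + 1) * k ^ d := by rw [mul_pow, add_mul, one_mul, mul_assoc]; omega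
  rw [Real.norm_of_nonneg (by positivity), Real.norm_of_nonneg (by positivity)]
  exact_mod_cast h4

end GeneralPosition

theorem mainTheorem7 {α : Type*} :
    -- the matroid lemma
    (∀ (M : Matroid α) (r k : ℕ) (Y : Finset α), M.eRank = r → (Y : Set α) ⊆ M.E →
      (2 ≤ k → r ≤ 2 * k - 1) →
      (∃ A : Finset α, (M.circuitHypergraph r Y).IsIndependent (A : Set α) ∧
        (r - 1) * (2 * k - 2).choose (r - 1) < A.card) →
      (k : ℕ∞) ≤ (M.circuitHypergraph r Y).independenceComplex.eta) ∧
    -- the bound for general position complexes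
    (∀ (d k : ℕ) (P : Set (EuclideanSpace ℝ (Fin d))), (3 ≤ k → d ≤ 2 * k - 2) →
      ((d * (2 * k - 2).choose d : ℕ) : ℕ∞) < maxGeneralPosition d P →
      (k : ℕ∞) ≤ (generalPositionComplex d P).eta) ∧
    -- for every `d`, the function `g_d` exists and is `O(k^d)`
    (∀ d : ℕ, ∃ g : ℕ → ℕ, (∀ k : ℕ, IsLeast (generalPositionThresholds d k) (g k)) ∧
      (fun k : ℕ => (g k : ℝ)) =O[Filter.atTop] (fun k : ℕ => (k : ℝ) ^ d)) := by
  refine ⟨fun M r k Y _ hY hrk ⟨A, hA, hcard⟩ =>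
    M.le_eta_independenceComplex_circuitHypergraph r k Y hY hrk A hA hcard, fun d k P hdk hP =>
    (generalPositionComplex_isHomConnected k P hdk hP).le_eta,
    exists_isLeast_generalPositionThresholds⟩
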